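/- For integers $n\ge 1$ and $k\ge 0$, let $d(n,k)$ be the number of derangements (permutations without fixed points) of an $n$-element set that have exactly $k$ cycles, let $D(n)$ be the total number of derangements of an $n$-element set, and let \[ D_n(x)=\sum_{k=1}^{\lfloor n/2\rfloor} d(n,k)\,x^k . \] Then for every complex number $v\neq 1$ with $|v|=1$, \[ \lim_{n\to\infty}\frac{D_n(v)}{D(n)}=0 . \] -/

import Mathlib

open Filter Topology

/-- The number `d(n,k)` of derangements (permutations without fixed points) of an `n`-element set
having exactly `k` cycles in their disjoint cycle decomposition. The parts of `σ.partition` are the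
lengths of all cycles of `σ`, so their number is the number of cycles of `σ`. -/
def derangementCycleNumber (n k : ℕ) : ℕ :=
  (Finset.univ.filter fun σ : Equiv.Perm (Fin n) =>
    σ ∈ derangements (Fin n) ∧ σ.partition.parts.card = k).card

/-- The generating polynomial `D_n(x) = ∑_{k=1}^{⌊n/2⌋} d(n,k) x^k` of the derangements of length
`n` according to their number of cycles. -/
noncomputable def derangementPoly (n : ℕ) : Polynomial ℂ :=
  ∑ k ∈ Finset.Icc 1 (n / 2),
    Polynomial.C (derangementCycleNumber n k : ℂ) * Polynomial.X ^ k

/-! Weighting each permutation of `m` points by `v` to the number of its cycles gives the rising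
factorial `v(v+1)⋯(v+m-1)` (`sum_pow_card_partition_parts`). Inclusion–exclusion over fixed points
then makes `D_n(v)/n!` the convolution of `(-v)^k/k!` with `c_m = v(v+1)⋯(v+m-1)/m!`. For `|v| = 1`,
`v ≠ 1`, the factor `|v+j|/(j+1)` falls below 1 by an amount of order `(1 - Re v)/j`, so divergence
of the harmonic series forces `c_m → 0`. Convolving this bounded null sequence with a summable one
gives a null sequence, and `D(n)/n! → 1/e ≠ 0`. -/

/-! ### Cycle counts and the rising factorial. -/

open Equiv Equiv.Perm in
theorem Equiv.Perm.card_partition_parts_add_card_support {α : Type*} [Fintype α] [DecidableEq α]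
    (σ : Perm α) :
    σ.partition.parts.card + σ.support.card = σ.cycleType.card + Fintype.card α := by
  have h := σ.support.card_le_univ
  rw [parts_partition, Multiset.card_add, Multiset.card_replicate]
  omega

open Equiv Equiv.Perm in
theorem Equiv.Perm.card_partition_parts_extendDomain {α β : Type*} [Fintype α] [DecidableEq α]
    [Fintype β] [DecidableEq β] {p : β → Prop} [DecidablePred p] (f : α ≃ Subtype p) (σ : Perm α) :
    (σ.extendDomain f).partition.parts.card + Fintype.card α =
      σ.partition.parts.card + Fintype.card β := by
  have h₁ := card_partition_parts_add_card_support σ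
  have h₂ := card_partition_parts_add_card_support (σ.extendDomain f)
  rw [cycleType_extendDomain, card_support_extend_domain] at h₂
  omega

open Equiv Equiv.Perm in
theorem Equiv.Perm.card_partition_parts_permCongr {α β : Type*} [Fintype α] [DecidableEq α]
    [Fintype β] [DecidableEq β] (e : α ≃ β) (σ : Perm α) :
    (e.permCongr σ).partition.parts.card = σ.partition.parts.card := by
  have h : e.permCongr σ =
      σ.extendDomain (e.trans (Equiv.subtypeUnivEquiv (p := fun _ : β => True) (by simp)).symm) := by
    ext b
    rw [extendDomain_apply_subtype _ _ trivial]
    rfl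
  have h' := card_partition_parts_extendDomain
    (e.trans (Equiv.subtypeUnivEquiv (p := fun _ : β => True) (by simp)).symm) σ
  rw [← h] at h'
  have hcard := Fintype.card_congr e
  omega

open Equiv Equiv.Perm in
theorem Equiv.Perm.card_partition_parts_optionCongr {α : Type*} [Fintype α] [DecidableEq α]
    (σ : Perm α) :
    (partition (α := Option α) (optionCongr σ)).parts.card = σ.partition.parts.card + 1 := by
  have h : (optionCongr σ : Perm (Option α)) = σ.extendDomain (Equiv.optionIsSomeEquiv α).symm := by
    ext1 b
    cases b with
    | none => rw [extendDomain_apply_not_subtype _ _ (by simp)]; rfl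
    | some b => rw [extendDomain_apply_subtype _ _ (by simp)]; rfl
  have h' := card_partition_parts_extendDomain (Equiv.optionIsSomeEquiv α).symm σ
  rw [← h] at h'
  have hcard := Fintype.card_option (α := α)
  omega

open Equiv Equiv.Perm in
/-- Multiplying by a transposition inserts a fixed point into the cycle of another point. -/
theorem Equiv.Perm.exists_cycleType_swap_mul {α : Type*} [Fintype α] [DecidableEq α] {τ : Perm α}
    {x y : α} (hxy : x ≠ y) (hx : τ x = x) :
    (swap x y * τ).cycleType = 2 ::ₘ τ.cycleType ∨ ∃ (k : ℕ) (s : Multiset ℕ),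
      τ.cycleType = k ::ₘ s ∧ (swap x y * τ).cycleType = (k + 1) ::ₘ s := by
  by_cases hy : τ y = y
  · left
    have hd : (swap x y).Disjoint τ := by
      intro z
      by_cases h1 : z = x
      · exact Or.inr (h1 ▸ hx)
      by_cases h2 : z = y
      · exact Or.inr (h2 ▸ hy)
      exact Or.inl (swap_apply_of_ne_of_ne h1 h2)
    rw [hd.cycleType_mul, (isCycle_swap hxy).cycleType, card_support_swap hxy]
    rfl
  · right
    have hys : y ∈ τ.support := mem_support.2 hy
    -- `r` collects the other cycles of `τ`; only the cycle through `y` changes, and `x` is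
    -- prepended to its list of points.
    obtain ⟨r, hr⟩ : ∃ r, r = τ * (τ.cycleOf y)⁻¹ := ⟨_, rfl⟩
    have hdisj : r.Disjoint (τ.cycleOf y) := hr ▸ disjoint_mul_inv_of_mem_cycleFactorsFinset
      (cycleOf_mem_cycleFactorsFinset_iff.2 hys)
    have hτ : τ = τ.cycleOf y * r := by
      rw [← hdisj.commute.eq, hr, inv_mul_cancel_right]
    have hc : (τ.cycleOf y).IsCycle := isCycle_cycleOf _ hy
    have hlen := two_le_length_toList_iff_mem_support.2 hys
    obtain ⟨t, ht⟩ : ∃ t, τ.toList y = y :: t := by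
      have h0 := toList_getElem_zero τ y hys
      cases h : τ.toList y with
      | nil => simp [h] at hlen
      | cons a t => simp [h] at h0; exact ⟨t, by rw [h0]⟩
    have hxl : x ∉ τ.toList y := by
      rw [mem_toList_iff]
      rintro ⟨h, -⟩
      exact hy ((h.apply_eq_self_iff).2 hx)
    have hnd : (x :: τ.toList y).Nodup := List.nodup_cons.2 ⟨hxl, nodup_toList _ _⟩
    have hform : (x :: τ.toList y).formPerm = swap x y * τ.cycleOf y := by
      rw [← formPerm_toList τ y, ht, List.formPerm_cons_cons]
    have hcyc : (swap x y * τ.cycleOf y).IsCycle := by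
      rw [← hform]
      exact List.isCycle_formPerm hnd (by simp; omega)
    have hcard : (swap x y * τ.cycleOf y).support.card = (τ.cycleOf y).support.card + 1 := by
      rw [← hform, List.support_formPerm_of_nodup _ hnd (by rintro z h; rw [ht] at h; cases h),
        List.toFinset_card_of_nodup hnd, List.length_cons, length_toList]
    have hcx : τ.cycleOf y x = x := by
      by_contra h
      have := (mem_support_cycleOf_iff.1 (mem_support.2 h)).1
      exact hy (this.apply_eq_self_iff.2 hx)
    have hrx : r x = x := by
      rw [hr, mul_apply, (Perm.inv_eq_iff_eq).2 hcx.symm, hx]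
    have hry : r y = y := (hdisj y).resolve_right (by simpa using hy)
    have hdisj' : (swap x y * τ.cycleOf y).Disjoint r := by
      refine Disjoint.mul_left ?_ hdisj.symm
      intro z
      by_cases h1 : z = x
      · exact Or.inr (h1 ▸ hrx)
      by_cases h2 : z = y
      · exact Or.inr (h2 ▸ hry)
      exact Or.inl (swap_apply_of_ne_of_ne h1 h2)
    refine ⟨(τ.cycleOf y).support.card, r.cycleType, ?_, ?_⟩
    · conv_lhs => rw [hτ]
      rw [hdisj.symm.cycleType_mul, hc.cycleType]
      rfl
    · conv_lhs => rw [hτ]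
      rw [← mul_assoc, hdisj'.cycleType_mul, hcyc.cycleType, hcard]
      rfl

-- The fixed point `x` stops being a cycle of its own and joins the cycle of `y`.
open Equiv Equiv.Perm in
theorem Equiv.Perm.card_partition_parts_swap_mul {α : Type*} [Fintype α] [DecidableEq α]
    {τ : Perm α} {x y : α} (hxy : x ≠ y) (hx : τ x = x) :
    (swap x y * τ).partition.parts.card + 1 = τ.partition.parts.card := by
  have h₁ := card_partition_parts_add_card_support τ
  have h₂ := card_partition_parts_add_card_support (swap x y * τ)
  rw [← sum_cycleType] at h₁ h₂
  rcases exists_cycleType_swap_mul hxy hx with h | ⟨k, s, h, h'⟩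
  · rw [h] at h₂
    simp only [Multiset.card_cons, Multiset.sum_cons] at h₁ h₂
    omega
  · rw [h'] at h₂
    rw [h] at h₁
    simp only [Multiset.card_cons, Multiset.sum_cons] at h₁ h₂
    omega

open Equiv Equiv.Perm in
theorem Equiv.Perm.sum_pow_card_partition_parts_congr {R : Type*} [CommSemiring R] (v : R)
    {α β : Type*} [Fintype α] [DecidableEq α] [Fintype β] [DecidableEq β] (e : α ≃ β) :
    ∑ σ : Perm α, v ^ σ.partition.parts.card = ∑ σ : Perm β, v ^ σ.partition.parts.card :=
  Fintype.sum_equiv e.permCongr _ _ fun σ => by rw [card_partition_parts_permCongr]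

open Equiv Equiv.Perm in
theorem Equiv.Perm.sum_pow_card_partition_parts {R : Type*} [CommSemiring R] (v : R)
    (α : Type*) [Fintype α] [DecidableEq α] :
    ∑ σ : Perm α, v ^ σ.partition.parts.card = (ascPochhammer R (Fintype.card α)).eval v := by
  rw [sum_pow_card_partition_parts_congr v (Fintype.equivFin α)]
  induction Fintype.card α with
  | zero => simp [parts_partition, Subsingleton.elim _ (1 : Perm (Fin 0))]
  | succ n ih =>
    -- The factor `v + n`: the new point is either a cycle by itself, or is inserted next to one of
    -- the `n` old points, which keeps the cycle count.
    rw [ascPochhammer_succ_eval, ← ih,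
      ← sum_pow_card_partition_parts_congr v (finSuccEquiv n).symm,
      ← decomposeOption.symm.sum_comp, Fintype.sum_prod_type_right, Finset.sum_mul]
    refine Finset.sum_congr rfl fun σ _ => ?_
    rw [Fintype.sum_option]
    have h : ∀ a : Fin n, (decomposeOption.symm (some a, σ)).partition.parts.card =
        σ.partition.parts.card := fun a => by
      have h₁ := card_partition_parts_swap_mul (τ := (optionCongr σ : Perm (Option (Fin n)))) (x := none) (y := some a)
        (by simp) (by simp)
      rw [card_partition_parts_optionCongr] at h₁
      exact Nat.succ_injective h₁
    have h₀ : (decomposeOption.symm ((none : Option (Fin n)), σ)).partition.parts.card =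
        σ.partition.parts.card + 1 := by
      rw [← card_partition_parts_optionCongr, decomposeOption_symm_apply, swap_self]
      rfl
    simp only [h, h₀, Finset.sum_const, Finset.card_univ, Fintype.card_fin, nsmul_eq_mul]
    ring

/-! ### Decay of rising factorials on the unit circle. -/

theorem Complex.norm_add_natCast_sq_of_norm_eq_one {v : ℂ} (hv : ‖v‖ = 1) (j : ℕ) :
    ‖v + j‖ ^ 2 = (j + 1 : ℝ) ^ 2 - 2 * j * (1 - v.re) := by
  have h : v.re * v.re + v.im * v.im = 1 := by
    rw [← Complex.normSq_apply, Complex.normSq_eq_norm_sq, hv, one_pow]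
  rw [← Complex.normSq_eq_norm_sq, Complex.normSq_apply]
  simp only [Complex.add_re, Complex.natCast_re, Complex.add_im, Complex.natCast_im, add_zero]
  linear_combination h

theorem Complex.re_lt_one_of_norm_eq_one {v : ℂ} (hv : ‖v‖ = 1) (hv1 : v ≠ 1) : v.re < 1 := by
  refine lt_of_le_of_ne (hv ▸ Complex.re_le_norm v) fun h => hv1 ?_
  have h' : v.re * v.re + v.im * v.im = 1 := by
    rw [← Complex.normSq_apply, Complex.normSq_eq_norm_sq, hv, one_pow]
  exact Complex.ext h (by simpa [h] using h')

theorem norm_ascPochhammer_eval_div_factorial_le_one {v : ℂ} (hv : ‖v‖ = 1) (m : ℕ) :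
    ‖(ascPochhammer ℂ m).eval v / (m.factorial : ℂ)‖ ≤ 1 := by
  induction m with
  | zero => simp
  | succ m ih =>
    have h : ‖v + m‖ ≤ m + 1 := (norm_add_le _ _).trans (by rw [hv]; simp [add_comm])
    have hm : (0 : ℝ) < m + 1 := by positivity
    have e : (ascPochhammer ℂ (m + 1)).eval v / ((m + 1).factorial : ℂ) =
        (ascPochhammer ℂ m).eval v / (m.factorial : ℂ) * ((v + m) / ((m + 1 : ℝ) : ℂ)) := by
      rw [ascPochhammer_succ_eval, Nat.factorial_succ, div_mul_div_comm]
      push_cast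
      ring
    rw [e, norm_mul]
    refine mul_le_one₀ ih (norm_nonneg _) ?_
    rw [norm_div, Complex.norm_of_nonneg hm.le]
    exact (div_le_one hm).2 h

theorem norm_sq_ascPochhammer_eval_div_factorial_le {v : ℂ} (hv : ‖v‖ = 1) (m : ℕ) :
    ‖(ascPochhammer ℂ (m + 1)).eval v / ((m + 1).factorial : ℂ)‖ ^ 2 ≤
      Real.exp (-(1 - v.re) * ∑ j ∈ Finset.range m, 1 / ((j : ℝ) + 2)) := by
  have hre : 0 ≤ 1 - v.re := sub_nonneg.2 (hv ▸ Complex.re_le_norm v)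
  induction m with
  | zero => simp [hv]
  | succ m ih =>
    have hm : (0 : ℝ) < m + 2 := by positivity
    have e : (ascPochhammer ℂ (m + 1 + 1)).eval v / ((m + 1 + 1).factorial : ℂ) =
        (ascPochhammer ℂ (m + 1)).eval v / ((m + 1).factorial : ℂ) *
          ((v + (m + 1 : ℕ)) / ((m + 2 : ℝ) : ℂ)) := by
      rw [ascPochhammer_succ_eval, Nat.factorial_succ (m + 1), div_mul_div_comm]
      push_cast
      ring
    rw [e, norm_mul, mul_pow, Finset.sum_range_succ, mul_add, Real.exp_add]
    refine mul_le_mul ih ?_ (by positivity) (Real.exp_nonneg _)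
    rw [norm_div, div_pow, Complex.norm_add_natCast_sq_of_norm_eq_one hv,
      Complex.norm_of_nonneg hm.le]
    -- The squared factor is `1 - 2(m+1)(1 - Re v)/(m+2)²`, at most `1 - (1 - Re v)/(m+2)` because
    -- `m+2 ≤ 2(m+1)`.
    refine le_trans ?_ (Real.add_one_le_exp _)
    rw [div_le_iff₀ (by positivity)]
    push_cast
    have : (-(1 - v.re) * (1 / (m + 2 : ℝ)) + 1) * (m + 2) ^ 2 =
        -(1 - v.re) * (m + 2) + (m + 2) ^ 2 := by
      field_simp
    rw [this]
    nlinarith [mul_nonneg hre (Nat.cast_nonneg m : (0 : ℝ) ≤ m)]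

theorem tendsto_ascPochhammer_eval_div_factorial {v : ℂ} (hv : ‖v‖ = 1) (hv1 : v ≠ 1) :
    Tendsto (fun m : ℕ => (ascPochhammer ℂ m).eval v / (m.factorial : ℂ)) atTop (𝓝 0) := by
  have hre : 0 < 1 - v.re := sub_pos.2 (Complex.re_lt_one_of_norm_eq_one hv hv1)
  have hsum : Tendsto (fun m => ∑ j ∈ Finset.range m, 1 / ((j : ℝ) + 2)) atTop atTop := by
    have h := (tendsto_add_atTop_iff_nat 1).2 Real.tendsto_sum_range_one_div_nat_succ_atTop
    refine (tendsto_atTop_add_const_right _ (-1) h).congr fun m => ?_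
    rw [Finset.sum_range_succ']
    simp only [Nat.cast_add, Nat.cast_one, add_assoc, one_add_one_eq_two]
    simp
  have hexp := Real.tendsto_exp_neg_atTop_nhds_zero.comp (hsum.const_mul_atTop hre)
  rw [← tendsto_add_atTop_iff_nat 1, tendsto_zero_iff_norm_tendsto_zero]
  have hsq := squeeze_zero (fun m => by positivity)
    (fun m => norm_sq_ascPochhammer_eval_div_factorial_le hv m)
    (hexp.congr fun m => by simp only [Function.comp_apply, neg_mul])
  simpa only [Real.sqrt_sq (norm_nonneg _), Real.sqrt_zero] using hsq.sqrt

/-- The convolution of a summable sequence with a bounded null sequence is a null sequence. -/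
theorem tendsto_sum_range_mul_sub_of_summable {a c : ℕ → ℂ} (ha : Summable fun k => ‖a k‖)
    {C : ℝ} (hC : ∀ m, ‖c m‖ ≤ C) (hc : Tendsto c atTop (𝓝 0)) :
    Tendsto (fun n => ∑ k ∈ Finset.range (n + 1), a k * c (n - k)) atTop (𝓝 0) := by
  -- Extending the finite sums by zero gives series dominated by `‖a k‖ * C`, whose terms tend to 0
  -- for each fixed `k`.
  have h := tendsto_tsum_of_dominated_convergence (𝓕 := atTop)
    (f := fun n k => if k ∈ Finset.range (n + 1) then a k * c (n - k) else 0)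
    (g := fun _ => 0) (ha.mul_right C)
    (fun k => by
      have hk : Tendsto (fun n => a k * c (n - k)) atTop (𝓝 0) := by
        simpa using (hc.comp (tendsto_sub_atTop_nat k)).const_mul (a k)
      refine hk.congr' ?_
      filter_upwards [eventually_ge_atTop k] with n hn
      rw [if_pos (by simp; omega)])
    (Eventually.of_forall fun n k => by
      have hC0 : 0 ≤ C := (norm_nonneg _).trans (hC 0)
      split_ifs
      · rw [norm_mul]
        exact mul_le_mul_of_nonneg_left (hC _) (norm_nonneg _)
      · simpa using mul_nonneg (norm_nonneg _) hC0)
  rw [tsum_zero] at h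
  refine h.congr fun n => ?_
  rw [tsum_eq_sum (s := Finset.range (n + 1)) fun k hk => if_neg hk]
  exact Finset.sum_congr rfl fun k hk => if_pos hk
-- Inclusion–exclusion for derangements.
open Equiv Equiv.Perm in
theorem Equiv.Perm.card_partition_parts_ofSubtype {α : Type*} [Fintype α] [DecidableEq α]
    (S : Finset α) (σ : Perm {x // x ∉ S}) :
    (ofSubtype σ).partition.parts.card = σ.partition.parts.card + S.card := by
  have h : (ofSubtype σ).partition.parts.card + Fintype.card {x // x ∉ S} =
      σ.partition.parts.card + Fintype.card α :=
    card_partition_parts_extendDomain (Equiv.refl _) σ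
  have hS := S.card_le_univ
  have hcard : Fintype.card {x // x ∉ S} = Fintype.card α - S.card := by
    rw [Fintype.card_subtype_compl, Fintype.card_coe]
  omega

-- Such permutations are those of the complement of `S`, and each point of `S` adds one cycle, hence
-- a factor `v`.
open Equiv Equiv.Perm in
theorem Equiv.Perm.sum_pow_card_partition_parts_of_fixed {R : Type*} [CommSemiring R] (v : R)
    {α : Type*} [Fintype α] [DecidableEq α] (S : Finset α) :
    ∑ σ : Perm α with ∀ a ∈ S, σ a = a, v ^ σ.partition.parts.card =
      v ^ S.card * (ascPochhammer R (Fintype.card α - S.card)).eval v := by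
  have hcard : Fintype.card {x // x ∉ S} = Fintype.card α - S.card := by
    rw [Fintype.card_subtype_compl, Fintype.card_coe]
  rw [← hcard, ← sum_pow_card_partition_parts, Finset.mul_sum]
  rw [Finset.sum_subtype (p := fun σ : Perm α => ∀ a, ¬ a ∉ S → σ a = a) _ (by simp)]
  refine (Fintype.sum_equiv (Perm.subtypeEquivSubtypePerm fun x => x ∉ S) _ _ fun σ => ?_).symm
  rw [Perm.subtypeEquivSubtypePerm_apply_coe, card_partition_parts_ofSubtype, pow_add, mul_comm]

open Equiv Equiv.Perm in
/-- Inclusion–exclusion over the fixed points. -/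
theorem sum_derangements_pow_card_partition_parts {R : Type*} [CommRing R] (v : R)
    (α : Type*) [Fintype α] [DecidableEq α] :
    ∑ σ : Perm α with σ ∈ derangements α, v ^ σ.partition.parts.card =
      ∑ k ∈ Finset.range (Fintype.card α + 1), ((Fintype.card α).choose k : R) * (-v) ^ k *
        (ascPochhammer R (Fintype.card α - k)).eval v := by
  -- The alternating sum over subsets of the fixed-point set vanishes unless that set is empty.
  have h₁ : ∀ σ : Perm α, (if σ ∈ derangements α then v ^ σ.partition.parts.card else 0) =
      ∑ S : Finset α, if ∀ a ∈ S, σ a = a then (-1) ^ S.card * v ^ σ.partition.parts.card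
        else 0 := fun σ => by
    have h := Finset.sum_powerset_neg_one_pow_card (x := Finset.univ.filter fun a => σ a = a)
    have h' : (Finset.univ.filter fun a => σ a = a).powerset =
        Finset.univ.filter fun S : Finset α => ∀ a ∈ S, σ a = a := by
      ext S
      simp [Finset.subset_iff]
    have h'' : (Finset.univ.filter fun a => σ a = a) = ∅ ↔ σ ∈ derangements α := by
      simp [Finset.filter_eq_empty_iff, derangements]
    rw [h', if_congr h'' rfl rfl] at h
    rw [← Finset.sum_filter, ← Finset.sum_mul]
    have hR := congrArg (Int.cast : ℤ → R) h
    push_cast at hR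
    rw [hR]
    split_ifs <;> simp
  rw [Finset.sum_filter, Finset.sum_congr rfl fun σ _ => h₁ σ, Finset.sum_comm]
  simp only [← Finset.sum_filter, ← Finset.mul_sum, sum_pow_card_partition_parts_of_fixed]
  rw [← Finset.powerset_univ, Finset.sum_powerset_apply_card
    (fun k => (-1) ^ k * (v ^ k * (ascPochhammer R (Fintype.card α - k)).eval v)), Finset.card_univ]
  refine Finset.sum_congr rfl fun k _ => ?_
  rw [nsmul_eq_mul, neg_pow]
  ring

open Equiv Equiv.Perm in
theorem card_partition_parts_of_mem_derangements {α : Type*} [Fintype α] [DecidableEq α]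
    {σ : Perm α} (hσ : σ ∈ derangements α) :
    σ.partition.parts.card = σ.cycleType.card := by
  have h : σ.support = Finset.univ := Finset.eq_univ_of_forall fun a => mem_support.2 (hσ a)
  have h' := card_partition_parts_add_card_support σ
  rw [h, Finset.card_univ] at h'
  omega

-- All cycles have length at least 2 and the lengths sum to `n`. The empty permutation, with no
-- cycle, is why `n ≠ 0` is required.
open Equiv Equiv.Perm in
theorem card_partition_parts_mem_Icc_of_mem_derangements {n : ℕ} (hn : n ≠ 0)
    {σ : Perm (Fin n)} (hσ : σ ∈ derangements (Fin n)) :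
    σ.partition.parts.card ∈ Finset.Icc 1 (n / 2) := by
  have h : σ.support = Finset.univ := Finset.eq_univ_of_forall fun a => mem_support.2 (hσ a)
  have hsum : σ.cycleType.sum = n := by
    rw [sum_cycleType, h, Finset.card_univ, Fintype.card_fin]
  have hle := Multiset.card_nsmul_le_sum (s := σ.cycleType) (a := 2)
    fun k hk => two_le_of_mem_cycleType hk
  have hpos : σ.cycleType ≠ 0 := by
    intro h0
    rw [h0, Multiset.sum_zero] at hsum
    exact hn hsum.symm
  have := Multiset.card_pos.2 hpos
  rw [card_partition_parts_of_mem_derangements hσ, Finset.mem_Icc]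
  rw [smul_eq_mul, hsum] at hle
  omega

theorem derangementPoly_eval {n : ℕ} (hn : n ≠ 0) (v : ℂ) :
    (derangementPoly n).eval v =
      ∑ σ : Equiv.Perm (Fin n) with σ ∈ derangements (Fin n), v ^ σ.partition.parts.card := by
  rw [derangementPoly, Polynomial.eval_finsetSum, ← Finset.sum_fiberwise_of_maps_to
    fun σ hσ => card_partition_parts_mem_Icc_of_mem_derangements hn (Finset.mem_filter.1 hσ).2]
  refine Finset.sum_congr rfl fun k _ => ?_
  rw [Finset.sum_congr rfl fun σ hσ => by rw [(Finset.mem_filter.1 hσ).2], Finset.sum_const,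
    Finset.filter_filter, nsmul_eq_mul]
  simp [derangementCycleNumber]

/-- Coefficient form of the generating function `e^{-vx} (1-x)^{-v}`. -/
theorem derangementPoly_eval_div_factorial {n : ℕ} (hn : n ≠ 0) (v : ℂ) :
    (derangementPoly n).eval v / (n.factorial : ℂ) =
      ∑ k ∈ Finset.range (n + 1), (-v) ^ k / (k.factorial : ℂ) *
        ((ascPochhammer ℂ (n - k)).eval v / ((n - k).factorial : ℂ)) := by
  rw [derangementPoly_eval hn, sum_derangements_pow_card_partition_parts, Fintype.card_fin,
    Finset.sum_div]
  refine Finset.sum_congr rfl fun k hk => ?_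
  have hk' : k ≤ n := by simpa [Nat.lt_succ_iff] using hk
  have h := Nat.choose_mul_factorial_mul_factorial hk'
  have h' : (n.choose k : ℂ) * k.factorial * (n - k).factorial = n.factorial := by exact_mod_cast h
  have h₁ : (n.factorial : ℂ) ≠ 0 := Nat.cast_ne_zero.2 n.factorial_ne_zero
  have h₂ : (k.factorial : ℂ) ≠ 0 := Nat.cast_ne_zero.2 k.factorial_ne_zero
  have h₃ : ((n - k).factorial : ℂ) ≠ 0 := Nat.cast_ne_zero.2 (n - k).factorial_ne_zero
  rw [div_mul_div_comm, div_eq_div_iff h₁ (mul_ne_zero h₂ h₃), ← h']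
  ring

theorem proposition1 (v : ℂ) (hv : ‖v‖ = 1) (hv1 : v ≠ 1) :
    Tendsto
      (fun n : ℕ => (derangementPoly n).eval v / (Fintype.card (derangements (Fin n)) : ℂ))
      atTop (𝓝 0) := by
  have hnum : Tendsto (fun n : ℕ => (derangementPoly n).eval v / (n.factorial : ℂ))
      atTop (𝓝 0) := by
    refine (tendsto_sum_range_mul_sub_of_summable
      (a := fun k => (-v) ^ k / (k.factorial : ℂ)) ?_
      (norm_ascPochhammer_eval_div_factorial_le_one hv)
      (tendsto_ascPochhammer_eval_div_factorial hv hv1)).congr' ?_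
    · exact NormedSpace.norm_expSeries_div_summable (-v)
    · filter_upwards [eventually_ne_atTop 0] with n hn
      exact (derangementPoly_eval_div_factorial hn v).symm
  have hden : Tendsto (fun n : ℕ => (numDerangements n : ℂ) / (n.factorial : ℂ))
      atTop (𝓝 ((Real.exp (-1) : ℝ) : ℂ)) :=
    ((Complex.continuous_ofReal.tendsto _).comp numDerangements_tendsto_inv_e).congr
      fun n => by simp
  have h := hnum.div hden (Complex.ofReal_ne_zero.2 (Real.exp_ne_zero _))
  rw [zero_div] at h
  refine h.congr fun n => ?_
  rw [Pi.div_apply, card_derangements_fin_eq_numDerangements,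
    div_div_div_cancel_right₀ (Nat.cast_ne_zero.2 n.factorial_ne_zero)]
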